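/- **Theorem.** There is a universal constant $C>0$ such that the following holds. Let $m,n\ge 1$ be integers, $K\ge 1$ and $\delta\in(0,1)$ with $$m\ \ge\ C\,\delta^{-4}\,n\,\log(eKn/\delta),$$ let $N\ge m+n$, and let $(a_j)_{j=0}^N$ be a random vector in $\mathbb R^{N+1}$ with independent coordinates that is isotropic (centered, with identity covariance matrix) and satisfies $$\mathcal L(a_j,\varepsilon):=\sup_{t\in\mathbb R}\mathbb P(|a_j-t|<\varepsilon)\le K\varepsilon\qquad\text{for all }0\le j\le N\text{ and }\varepsilon>0 .$$ Let $P_{mn}=\sum_{k=0}^m p_kz^k$ be the numerator of the $[m,n]$-Padé approximant of $f_N(z)=\sum_{j=0}^N a_jz^j$, that is, $\deg P_{mn}\le m$ and for some polynomial $Q_{mn}\not\equiv 0$ of degree at most $n$ all coefficients of $f_NQ_{mn}-P_{mn}$ of order at most $m+n$ vanish. Then $$\mathbb P\Big(\frac{\log L(P_{mn})}{m}>\delta^4\Big)<\delta,\qquad L(P_{mn})=\frac{|p_0|+|p_1|+\dots+|p_m|}{\sqrt{|p_0|\,|p_m|}} .$$ In particular, $$\mathbb P\big(d_{\rm BL}(\nu_{P_{mn}},\mu)>40\,\delta\big)<\delta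 ,$$ where $\mu$ is the uniform probability measure on the unit circle, $\nu_{P_{mn}}$ is the normalized zero-counting measure $\frac1m\sum_{j=1}^m\delta_{z_j}$ of the zeros $z_1,\dots,z_m$ of $P_{mn}$ (with multiplicity), and $d_{\rm BL}(\nu,\mu)=\sup|\int f\,d\nu-\int f\,d\mu|$ over all $f:\mathbb C\to\mathbb R$ with $\|f\|_{\rm Lip}+\|f\|_\infty\le 1$. In both statements the probability is the (outer) probability of the event that the displayed inequality holds, or $p_0p_m=0$, for at least one admissible choice of $P_{mn}$. -/

import Mathlib

open MeasureTheory ProbabilityTheory Polynomial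
open scoped ENNReal NNReal

noncomputable section

namespace PadeClustering

/-- Lévy concentration function `𝓛(ξ, ε) = sup_{t ∈ ℝ} Prob(|ξ - t| < ε)`. -/
def levyConcentration {Ω : Type*} [MeasurableSpace Ω] (μ : Measure Ω) (ξ : Ω → ℝ) (ε : ℝ) : ℝ≥0∞ :=
  ⨆ t : ℝ, μ {ω | |ξ ω - t| < ε}

/-- A random vector is isotropic if it is square integrable, centered, and its covariance matrix
is the identity. -/
structure IsIsotropic {Ω ι : Type*} [MeasurableSpace Ω] [DecidableEq ι] (μ : Measure Ω)
    (a : ι → Ω → ℝ) : Prop where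
  memLp : ∀ i, MemLp (a i) 2 μ
  centered : ∀ i, ∫ ω, a i ω ∂μ = 0
  covariance_eq : ∀ i j, covariance (a i) (a j) μ = if i = j then 1 else 0

/-- The polynomial `∑_{j=0}^N c_j z^j`. -/
def polyOfCoeffs {N : ℕ} (c : Fin (N + 1) → ℝ) : ℂ[X] :=
  ∑ j : Fin (N + 1), C (c j : ℂ) * X ^ (j : ℕ)

/-- `(P, Q)` is a pair of numerator and denominator of the `[m,n]`-Padé approximant of the power
series `f` in the sense of Frobenius: `deg P ≤ m`, `deg Q ≤ n`, `Q ≢ 0`, and all the coefficients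
of `f Q - P` of order at most `m + n` vanish. -/
structure IsPadePair (f : PowerSeries ℂ) (m n : ℕ) (P Q : ℂ[X]) : Prop where
  natDegree_num_le : P.natDegree ≤ m
  natDegree_den_le : Q.natDegree ≤ n
  den_ne_zero : Q ≠ 0
  coeff_eq_zero : ∀ k ≤ m + n,
    PowerSeries.coeff k (f * (Q : PowerSeries ℂ) - (P : PowerSeries ℂ)) = 0

/-- `P` is a numerator of the `[m,n]`-Padé approximant of `f`. -/
def IsPadeNumerator (f : PowerSeries ℂ) (m n : ℕ) (P : ℂ[X]) : Prop :=
  ∃ Q : ℂ[X], IsPadePair f m n P Q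

/-- Padé numerators always exist. -/
theorem exists_isPadeNumerator (f : PowerSeries ℂ) (m n : ℕ) : ∃ P, IsPadeNumerator f m n P := by
  let φ : degreeLT ℂ (n + 1) →ₗ[ℂ] (Fin n → ℂ) :=
    { toFun := fun q i => PowerSeries.coeff (m + 1 + i) (f * ((q : ℂ[X]) : PowerSeries ℂ))
      map_add' := by intro p q; ext i; simp [mul_add]
      map_smul' := by
        intro c q; ext i
        simp [Polynomial.smul_eq_C_mul, mul_left_comm f, PowerSeries.coeff_C_mul] }
  have hφ : LinearMap.ker φ ≠ ⊥ := by
    apply LinearMap.ker_ne_bot_of_finrank_lt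
    rw [(degreeLTEquiv ℂ (n + 1)).finrank_eq]
    simp
  obtain ⟨⟨q, hqd⟩, hq, hq0⟩ := (Submodule.ne_bot_iff _).1 hφ
  have hq0' : q ≠ 0 := fun h => hq0 (by ext1; exact h)
  refine ⟨PowerSeries.trunc (m + 1) (f * (q : PowerSeries ℂ)), q, ?_, ?_, hq0', ?_⟩
  · exact Nat.lt_succ_iff.1 (PowerSeries.natDegree_trunc_lt _ m)
  · exact Nat.lt_succ_iff.1 ((natDegree_lt_iff_degree_lt hq0').2 (mem_degreeLT.1 hqd))
  · intro k hk
    rw [map_sub, Polynomial.coeff_coe, PowerSeries.coeff_trunc]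
    split_ifs with h
    · simp
    · have := congrFun (LinearMap.mem_ker.1 hq) ⟨k - (m + 1), by omega⟩
      simp only [φ, LinearMap.coe_mk, AddHom.coe_mk, Pi.zero_apply] at this
      rw [show m + 1 + (k - (m + 1)) = k by omega] at this
      simp [this]

/-- The Erdős–Turán ratio
`L(P) = (|α₀| + ⋯ + |α_d|) / √(|α₀| |α_d|)` of `P = α₀ + ⋯ + α_d z^d` with `α₀ α_d ≠ 0`. -/
def erdosTuranRatio (P : ℂ[X]) : ℝ :=
  (∑ k ∈ Finset.range (P.natDegree + 1), ‖P.coeff k‖) /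
    √(‖P.coeff 0‖ * ‖P.coeff P.natDegree‖)

/-- The normalized zero-counting measure `ν_P = (1 / deg P) ∑_j δ_{z_j}`, where the `z_j` are the
zeros of `P` with multiplicity. -/
def zeroMeasure (P : ℂ[X]) : Measure ℂ :=
  (P.natDegree : ℝ≥0∞)⁻¹ • (P.roots.map Measure.dirac).sum

/-- The uniform probability measure on the unit circle, as the law of `e^{iθ}` with `θ` uniform
on `(0, 2π]`. -/
def uniformCircle : Measure ℂ :=
  (ENNReal.ofReal (2 * Real.pi))⁻¹ •
    (volume.restrict (Set.Ioc 0 (2 * Real.pi))).map (circleMap 0 1)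

/-- `‖f‖_Lip = sup_{x ≠ y} |f x - f y| / |x - y|`, in `[0, ∞]` (the diagonal contributes
`0 / 0 = 0`). -/
def lipNorm (f : ℂ → ℝ) : ℝ≥0∞ := ⨆ (x : ℂ) (y : ℂ), edist (f x) (f y) / edist x y

/-- `‖f‖_∞ = sup_x |f x|`, in `[0, ∞]`. -/
def uniformNorm (f : ℂ → ℝ) : ℝ≥0∞ := ⨆ x : ℂ, ‖f x‖ₑ

/-- The bounded Lipschitz metric: the supremum of `|∫ f dμ - ∫ f dν|` over all `f : ℂ → ℝ` with
`‖f‖_Lip + ‖f‖_∞ ≤ 1`. -/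
def dBL (μ ν : Measure ℂ) : ℝ :=
  sSup {r : ℝ | ∃ f : ℂ → ℝ, lipNorm f + uniformNorm f ≤ 1 ∧ r = |∫ z, f z ∂μ - ∫ z, f z ∂ν|}

end PadeClustering

end

noncomputable section

namespace PadeClustering

/-! A polynomial whose Erdős–Turán ratio `L` satisfies `log L ≤ δ⁴ deg` has zeros close to
equidistributed on the circle, so it suffices to bound `L` for the numerator.

Let `D_k` be the `k × k` Toeplitz determinant of the `a_{m+i-j}`. The Padé equations of orders `m,
…, m + n` form a Toeplitz system for the coefficients `q_l` of `Q`, with right-hand side `p_m e₀`.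
Cramer's rule expresses each `q_l` as `p_m` times a cofactor over `D_{n+1}`; the cofactor for `q_0`
is `D_n`, so `p_0 = a_0 p_m D_n / D_{n+1}`. Hence `L` is at most a power of `∑ |a_j|`, times `(m+1)
n!`, over `√(|D_n D_{n+1} a_0|)` (`erdosTuranRatio_le`).

The coefficient `a_m` occurs in `D_k` only on the diagonal, so `D_k` is a monic polynomial of degree
`k` in `a_m` whose coefficients depend on the other, independent, coordinates. If `|D_k| < ε^k`,
then `a_m` is within `ε` of the real part of one of its `k` roots, an event of probability at most
`kKε` (`measure_norm_det_toeplitz_lt_le`). Markov's inequality controls `∑ |a_j|`. Outside an event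
of probability at most `δ/2` this makes `log L` of order `n log(m/δ)` plus `n log(nK/δ)`, which the
lower bound on `m` absorbs.

For equidistribution, the zeros are projected to the circle: Jensen's formula bounds the radial
displacement, and Poisson smoothing together with a Borel–Carathéodory estimate handles the angles
(`abs_sum_sub_circleAverage_le`). -/

/-! ### Poisson smoothing and equidistribution of points on the circle. -/

/-- Infinitesimal form of the Borel–Carathéodory inequality. -/
lemma norm_deriv_le_of_re_lt {g : ℂ → ℂ} {M : ℝ} (hg : DifferentiableOn ℂ g (Metric.ball 0 1))
    (hM : ∀ z, ‖z‖ < 1 → (g z).re < M) {z : ℂ} (hz : ‖z‖ < 1) :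
    ‖deriv g z‖ ≤ 2 * (M - (g z).re) / (1 - ‖z‖) := by
  set R := 1 - ‖z‖ with hR
  have hR0 : 0 < R := by linarith
  have hball : ∀ ζ ∈ Metric.ball (0 : ℂ) R, ‖z + ζ‖ < 1 := by
    intro ζ hζ
    have h1 := norm_add_le z ζ
    have h2 : ‖ζ‖ < R := by simpa using hζ
    linarith
  have hf : DifferentiableOn ℂ (fun ζ => g (z + ζ) - g z) (Metric.ball 0 R) := by
    refine DifferentiableOn.sub_const ?_ _
    refine hg.comp (by fun_prop) fun ζ hζ => ?_
    simpa using hball ζ hζ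
  -- Borel–Carathéodory on the largest disc about `z` inside the unit disc. Dividing by `‖ζ‖` and
  -- letting `ζ → 0` gives the derivative bound.
  have hBC : ∀ ζ ∈ Metric.ball (0 : ℂ) R,
      ‖g (z + ζ) - g z‖ ≤ 2 * (M - (g z).re) * ‖ζ‖ / (R - ‖ζ‖) := by
    intro ζ hζ
    refine Complex.borelCaratheodory_zero (f := fun ζ => g (z + ζ) - g z)
      (by linarith [hM z hz]) hf ?_ hR0 hζ (by simp)
    intro ξ hξ
    have := hM _ (hball ξ hξ)
    simp only [Set.mem_ofPred_eq, Complex.sub_re]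
    linarith
  have hd : HasDerivAt g (deriv g z) z :=
    (hg.differentiableAt (Metric.isOpen_ball.mem_nhds (by simpa using hz))).hasDerivAt
  have h1 := (hasDerivAt_iff_tendsto_slope_zero.1 hd).norm
  have h2 : Filter.Tendsto (fun t : ℂ => 2 * (M - (g z).re) / (R - ‖t‖)) (nhdsWithin 0 {0}ᶜ)
      (nhds (2 * (M - (g z).re) / R)) := by
    have : ContinuousAt (fun t : ℂ => 2 * (M - (g z).re) / (R - ‖t‖)) 0 := by
      refine ContinuousAt.div (by fun_prop) (by fun_prop) (by simpa using hR0.ne')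
    have h3 := this.tendsto
    simp only [norm_zero, sub_zero] at h3
    exact h3.mono_left nhdsWithin_le_nhds
  refine le_of_tendsto_of_tendsto h1 h2 ?_
  have hmem : Metric.ball (0 : ℂ) R ∩ {0}ᶜ ∈ nhdsWithin (0 : ℂ) {0}ᶜ :=
    Filter.inter_mem (nhdsWithin_le_nhds (Metric.ball_mem_nhds 0 hR0)) self_mem_nhdsWithin
  filter_upwards [hmem] with t ht
  have ht0 : 0 < ‖t‖ := norm_pos_iff.2 ht.2
  have := hBC t ht.1
  rw [norm_smul, norm_inv]
  calc ‖t‖⁻¹ * ‖g (z + t) - g z‖ ≤ ‖t‖⁻¹ * (2 * (M - (g z).re) * ‖t‖ / (R - ‖t‖)) := by gcongr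
    _ = _ := by field_simp

lemma circleAverage_re {F : ℂ → ℂ} (hF : DifferentiableOn ℂ F (Metric.closedBall 0 1)) :
    CircleIntegrable (fun z => (F z).re) 0 1 ∧
      Real.circleAverage (fun z => (F z).re) 0 1 = (F 0).re := by
  have hc : ContinuousOn F (Metric.sphere 0 1) :=
    hF.continuousOn.mono Metric.sphere_subset_closedBall
  refine ⟨ContinuousOn.circleIntegrable zero_le_one (Complex.continuous_re.comp_continuousOn hc), ?_⟩
  have h1 : DiffContOnCl ℂ F (Metric.ball 0 |1|) := by
    refine DifferentiableOn.diffContOnCl ?_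
    simpa [closure_ball] using hF
  have h2 := h1.circleAverage
  have h3 := Complex.reCLM.circleAverage_comp_comm (hc.circleIntegrable zero_le_one)
  rw [h2] at h3
  exact h3

lemma re_one_add_div_one_sub {u : ℂ} (hu : u ≠ 1) :
    ((1 + u) / (1 - u)).re = (1 - ‖u‖ ^ 2) / ‖1 - u‖ ^ 2 := by
  have h : Complex.normSq (1 - u) ≠ 0 := by
    simpa [sub_eq_zero] using hu.symm
  rw [Complex.div_re, ← Complex.normSq_eq_norm_sq, ← Complex.normSq_eq_norm_sq, ← add_div]
  congr 1
  simp [Complex.normSq_apply]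
  ring

/-- Rewrites the denominator of the Poisson kernel in terms of the chord length `‖1 - s‖`. -/
lemma norm_one_sub_mul_sq {r : ℝ} {s : ℂ} (hs : ‖s‖ = 1) :
    ‖1 - (r : ℂ) * s‖ ^ 2 = (1 - r) ^ 2 + r * ‖1 - s‖ ^ 2 := by
  have h : s.re * s.re + s.im * s.im = 1 := by
    rw [← Complex.normSq_apply, Complex.normSq_eq_norm_sq, hs]; norm_num
  rw [← Complex.normSq_eq_norm_sq, ← Complex.normSq_eq_norm_sq]
  simp [Complex.normSq_apply]
  linear_combination (r ^ 2 - r) * h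

/-- The Poisson kernel of radius `1 - δ² / 2` is nonnegative and concentrated at scale `δ`. -/
lemma poisson_concentration {δ : ℝ} (h0 : 0 < δ) (h1 : δ < 1) {s : ℂ} (hs : ‖s‖ = 1) :
    0 ≤ ((1 + ((1 - δ ^ 2 / 2 : ℝ) : ℂ) * s) / (1 - ((1 - δ ^ 2 / 2 : ℝ) : ℂ) * s)).re ∧
    ‖1 - s‖ * ((1 + ((1 - δ ^ 2 / 2 : ℝ) : ℂ) * s) / (1 - ((1 - δ ^ 2 / 2 : ℝ) : ℂ) * s)).re ≤
      δ / 2 * ((1 + ((1 - δ ^ 2 / 2 : ℝ) : ℂ) * s) / (1 - ((1 - δ ^ 2 / 2 : ℝ) : ℂ) * s)).re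
        + δ := by
  set r : ℝ := 1 - δ ^ 2 / 2 with hr
  have hδ2 : δ ^ 2 < 1 := by nlinarith
  have hr2 : 1 / 2 ≤ r := by linarith
  have hr1 : r < 1 := by nlinarith
  have hn : ‖(r : ℂ) * s‖ = r := by
    rw [norm_mul, hs, mul_one, Complex.norm_real, Real.norm_of_nonneg (by linarith)]
  have hne : (r : ℂ) * s ≠ 1 := by
    intro h; rw [h, norm_one] at hn; linarith
  rw [re_one_add_div_one_sub hne, hn, norm_one_sub_mul_sq hs]
  set X := ‖1 - s‖
  have hX : 0 ≤ X := norm_nonneg _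
  have hden : 0 < (1 - r) ^ 2 + r * X ^ 2 := by
    have : 0 < (1 - r) ^ 2 := by have : 0 < 1 - r := by linarith
                                 positivity
    positivity
  set K := (1 - r ^ 2) / ((1 - r) ^ 2 + r * X ^ 2) with hK
  have hK0 : 0 ≤ K := div_nonneg (by nlinarith) hden.le
  refine ⟨hK0, ?_⟩
  have hKX : K * X ^ 2 ≤ 2 * δ ^ 2 := by
    rw [hK, div_mul_eq_mul_div, div_le_iff₀ hden]
    have h3 : 1 - r ^ 2 ≤ δ ^ 2 := by nlinarith [sq_nonneg δ]
    have h4 : (1 - r ^ 2) * X ^ 2 ≤ δ ^ 2 * X ^ 2 := by gcongr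
    have h5 : δ ^ 2 * X ^ 2 ≤ 2 * δ ^ 2 * (r * X ^ 2) := by
      have : 0 ≤ δ ^ 2 * X ^ 2 := by positivity
      nlinarith
    nlinarith [mul_nonneg (sq_nonneg δ) (sq_nonneg (1 - r))]
  -- AM–GM trades the first moment of the kernel for its mass and the bounded quantity `K * X ^ 2`.
  have h6 : 2 * δ * (X * K) ≤ δ ^ 2 * K + K * X ^ 2 := by nlinarith [mul_nonneg hK0 (sq_nonneg (X - δ))]
  have h7 : 2 * δ * (X * K) ≤ 2 * δ * (δ / 2 * K + δ) := by nlinarith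
  exact le_of_mul_le_mul_left h7 (by positivity)

lemma one_sub_mem_slitPlane {u : ℂ} (hu : ‖u‖ < 1) : 1 - u ∈ Complex.slitPlane := by
  left
  have := Complex.re_le_norm u
  simp only [Complex.sub_re, Complex.one_re]
  linarith

/-- Equidistribution of points on the unit circle, from an upper bound of the polynomial
vanishing at them. -/
lemma abs_sum_sub_circleAverage_le {ι : Type*} [Fintype ι] {w : ι → ℂ} (hw : ∀ j, ‖w j‖ = 1)
    {M δ : ℝ} (h0 : 0 < δ) (h1 : δ < 1)
    (hM : ∀ z : ℂ, ‖z‖ < 1 → ∏ j, ‖1 - (starRingEnd ℂ) (w j) * z‖ < Real.exp M)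
    {f : ℂ → ℝ} (hf : ∀ x y, |f x - f y| ≤ ‖x - y‖) (hf1 : ∀ x, |f x| ≤ 1) :
    |∑ j, f (w j) - Fintype.card ι * Real.circleAverage f 0 1| ≤
      3 / 2 * δ * Fintype.card ι + 8 * M / δ ^ 2 := by
  set r : ℝ := 1 - δ ^ 2 / 2 with hr
  set v : ι → ℂ := fun j => (starRingEnd ℂ) (w j) with hv
  have hvn : ∀ j, ‖v j‖ = 1 := fun j => by simp [hv, hw]
  have hδ2 : δ ^ 2 < 1 := by nlinarith
  have hr2 : 1 / 2 ≤ r := by linarith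
  have hr1 : r < 1 := by nlinarith
  have hvz : ∀ j (z : ℂ), ‖z‖ < 1 → ‖v j * z‖ < 1 := fun j z hz => by
    rw [norm_mul, hvn, one_mul]; exact hz
  have hrz : ∀ z : ℂ, ‖z‖ ≤ 1 → ‖(r : ℂ) * z‖ < 1 := fun z hz => by
    rw [norm_mul, Complex.norm_real, Real.norm_of_nonneg (by linarith)]
    nlinarith [norm_nonneg z]
  set g : ℂ → ℂ := fun z => ∑ j, Complex.log (1 - v j * z) with hg
  have hgd : ∀ z, ‖z‖ < 1 → HasDerivAt g (∑ j, (-v j) / (1 - v j * z)) z := by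
    intro z hz
    refine HasDerivAt.fun_sum fun j _ => ?_
    have : HasDerivAt (fun z => 1 - v j * z) (-v j) z := by
      simpa using ((hasDerivAt_id z).const_mul (v j)).const_sub 1
    exact this.clog (one_sub_mem_slitPlane (hvz j z hz))
  have hgdiff : DifferentiableOn ℂ g (Metric.ball 0 1) := fun z hz =>
    (hgd z (by simpa using hz)).differentiableAt.differentiableWithinAt
  have hgre : ∀ z, ‖z‖ < 1 → (g z).re < M := by
    intro z hz
    have hpos : ∀ j, ‖1 - v j * z‖ ≠ 0 := fun j =>
      norm_ne_zero_iff.2 (Complex.slitPlane_ne_zero (one_sub_mem_slitPlane (hvz j z hz)))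
    have : (g z).re = Real.log (∏ j, ‖1 - v j * z‖) := by
      rw [Real.log_prod (fun j _ => hpos j)]
      simp [hg, Complex.log_re]
    rw [this, Real.log_lt_iff_lt_exp]
    · exact hM z hz
    · exact Finset.prod_pos fun j _ => lt_of_le_of_ne (norm_nonneg _) (hpos j).symm
  set K : ι → ℂ → ℝ := fun j z => ((1 + v j * (r * z)) / (1 - v j * (r * z))).re with hK
  have hKav : ∀ j, CircleIntegrable (K j) 0 1 ∧ Real.circleAverage (K j) 0 1 = 1 := by
    intro j
    have := circleAverage_re (F := fun z => (1 + v j * (r * z)) / (1 - v j * (r * z))) ?_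
    · refine ⟨this.1, this.2.trans ?_⟩
      simp
    · refine DifferentiableOn.div (by fun_prop) (by fun_prop) fun z hz => ?_
      exact Complex.slitPlane_ne_zero
        (one_sub_mem_slitPlane (hvz j _ (hrz z (by simpa using hz))))
  have hgav := circleAverage_re (F := fun z => g (r * z)) (by
    intro z hz
    have hz' := hrz z (by simpa using hz)
    have := (hgd _ hz').differentiableAt
    exact (DifferentiableAt.comp z this (by fun_prop)).differentiableWithinAt)
  have hg0 : (g (r * 0)).re = 0 := by simp [hg]
  rw [hg0] at hgav
  have hfc : Continuous f := by
    refine LipschitzWith.continuous (K := 1) (LipschitzWith.of_dist_le_mul fun x y => ?_)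
    simpa [Real.dist_eq, dist_eq_norm] using hf x y
  have hfi : CircleIntegrable f 0 1 := hfc.continuousOn.circleIntegrable zero_le_one
  set m : ℝ := (Fintype.card ι : ℝ) with hm
  -- Since `(1 + u) / (1 - u) = 1 + 2u / (1 - u)`, the excess of the smoothed point measure is the
  -- real part of `-2rz g'(rz)`. The resulting bound is useful because `Re g` is harmonic with `g 0
  -- = 0`, so `M - Re g` averages to `M`.
  have hsumK : ∀ z : ℂ, ‖z‖ = 1 → |∑ j, K j z - m| ≤ 4 * (M - (g (r * z)).re) / (1 - r) := by
    intro z hz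
    have hz' := hrz z hz.le
    have e : ∑ j, K j z - m = (-2 * (r * z) * deriv g (r * z)).re := by
      rw [(hgd _ hz').deriv, Finset.mul_sum, Complex.re_sum, hm, Fintype.card,
        Finset.cast_card, ← Finset.sum_sub_distrib]
      refine Finset.sum_congr rfl fun j _ => ?_
      have hne := Complex.slitPlane_ne_zero (one_sub_mem_slitPlane (hvz j _ hz'))
      have : (1 + v j * (r * z)) / (1 - v j * (r * z)) =
          1 + -2 * (r * z) * (-v j / (1 - v j * (r * z))) := by
        have h3 : ∀ u : ℂ, 1 - u ≠ 0 → (1 + u) / (1 - u) = 1 + 2 * (u / (1 - u)) := by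
          intro u hu
          field_simp
          ring
        rw [h3 _ hne]
        ring
      simp only [hK]
      rw [this, Complex.add_re, Complex.one_re]
      ring
    rw [e]
    have hrn : ‖(r : ℂ) * z‖ = r := by
      rw [norm_mul, hz, mul_one, Complex.norm_real, Real.norm_of_nonneg (by linarith)]
    calc _ ≤ ‖-2 * (r * z) * deriv g (r * z)‖ := Complex.abs_re_le_norm _
      _ = 2 * r * ‖deriv g (r * z)‖ := by rw [norm_mul, norm_mul, hrn]; simp
      _ ≤ 2 * 1 * (2 * (M - (g (r * z)).re) / (1 - r)) := by
        have := norm_deriv_le_of_re_lt hgdiff hgre hz'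
        rw [hrn] at this
        gcongr
      _ = _ := by ring
  have hKi : ∀ c : ι → ℝ, CircleIntegrable (fun z => ∑ j, c j * K j z) 0 1 := fun c =>
    CircleIntegrable.fun_sum _ fun j _ => (hKav j).1.const_fun_smul (a := c j)
  have hKa : ∀ c : ι → ℝ, Real.circleAverage (fun z => ∑ j, c j * K j z) 0 1 = ∑ j, c j := by
    intro c
    refine (Real.circleAverage_fun_sum (f := fun j z => c j * K j z)
      fun j _ => (hKav j).1.const_fun_smul (a := c j)).trans ?_
    refine Finset.sum_congr rfl fun j _ => ?_
    have := Real.circleAverage_fun_smul (a := c j) (f := K j) (c := 0) (R := 1)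
    simp only [smul_eq_mul, (hKav j).2, mul_one] at this
    exact this
  have hmfi : CircleIntegrable (fun z => m * f z) 0 1 := hfi.const_fun_smul (a := m)
  have hHav : Real.circleAverage (fun z => ∑ j, f (w j) * K j z - m * f z) 0 1 =
      ∑ j, f (w j) - m * Real.circleAverage f 0 1 := by
    rw [Real.circleAverage_fun_sub (hKi _) hmfi, hKa]
    congr 1
    exact Real.circleAverage_fun_smul (a := m) (f := f)
  have hHint : CircleIntegrable (fun z => ∑ j, f (w j) * K j z - m * f z) 0 1 :=
    (hKi _).sub hmfi
  have hgi : CircleIntegrable (fun z => 4 / (1 - r) * (g (r * z)).re) 0 1 :=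
    hgav.1.const_fun_smul (a := 4 / (1 - r))
  have hconst : CircleIntegrable (fun _ => m * δ + 4 * M / (1 - r)) 0 1 :=
    circleIntegrable_const _ _ _
  have hGint : CircleIntegrable (fun z => (∑ j, δ / 2 * K j z + (m * δ + 4 * M / (1 - r)))
      - 4 / (1 - r) * (g (r * z)).re) 0 1 := ((hKi _).add hconst).sub hgi
  have hGav : Real.circleAverage (fun z => (∑ j, δ / 2 * K j z + (m * δ + 4 * M / (1 - r)))
      - 4 / (1 - r) * (g (r * z)).re) 0 1 = 3 / 2 * δ * m + 8 * M / δ ^ 2 := by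
    have e := Real.circleAverage_fun_smul (a := 4 / (1 - r)) (f := fun z => (g (r * z)).re)
      (c := 0) (R := 1)
    rw [hgav.2, smul_zero] at e
    simp only [smul_eq_mul] at e
    rw [Real.circleAverage_fun_sub ((hKi _).fun_add hconst) hgi, e,
      Real.circleAverage_fun_add (hKi _) hconst, hKa, Real.circleAverage_const]
    simp only [Finset.sum_const, Finset.card_univ, nsmul_eq_mul, hr]
    field_simp
    ring
  -- Replacing `f (w j)` by `f z` costs at most `‖w j - z‖ * K j z`, controlled by concentration;
  -- what remains is `f z` times the excess in `hsumK`. Averaging over the circle finishes the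
  -- proof, with `1 - r = δ² / 2`.
  have hpt : ∀ z ∈ Metric.sphere (0 : ℂ) |1|, |∑ j, f (w j) * K j z - m * f z| ≤
      (∑ j, δ / 2 * K j z + (m * δ + 4 * M / (1 - r))) - 4 / (1 - r) * (g (r * z)).re := by
    intro z hz
    have hz1 : ‖z‖ = 1 := by simpa using hz
    have e : ∑ j, f (w j) * K j z - m * f z =
        ∑ j, (f (w j) - f z) * K j z + f z * (∑ j, K j z - m) := by
      simp only [sub_mul, Finset.sum_sub_distrib, ← Finset.mul_sum]
      ring
    have hA : |∑ j, (f (w j) - f z) * K j z| ≤ ∑ j, (δ / 2 * K j z + δ) := by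
      refine (Finset.abs_sum_le_sum_abs _ _).trans (Finset.sum_le_sum fun j _ => ?_)
      obtain ⟨p1, p2⟩ := poisson_concentration h0 h1 (s := v j * z) (by rw [norm_mul, hvn, hz1, one_mul])
      have eK : K j z = ((1 + ((1 - δ ^ 2 / 2 : ℝ) : ℂ) * (v j * z)) /
          (1 - ((1 - δ ^ 2 / 2 : ℝ) : ℂ) * (v j * z))).re := by
        simp only [hK, ← hr, mul_left_comm]
      rw [← eK] at p1 p2
      rw [abs_mul, abs_of_nonneg p1]
      refine le_trans ?_ p2
      gcongr
      refine (hf _ _).trans (le_of_eq ?_)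
      have : w j - z = w j * (1 - v j * z) := by
        have h3 : w j * v j = 1 := by
          simp [hv, Complex.mul_conj, Complex.normSq_eq_norm_sq, hw]
        linear_combination z * h3
      rw [this, norm_mul, hw, one_mul]
    have hB : |f z * (∑ j, K j z - m)| ≤ 4 * (M - (g (r * z)).re) / (1 - r) := by
      rw [abs_mul]
      have := hsumK z hz1
      have h3 := mul_le_mul (hf1 z) this (abs_nonneg _) zero_le_one
      rwa [one_mul] at h3
    rw [e]
    refine (abs_add_le _ _).trans ((add_le_add hA hB).trans (le_of_eq ?_))
    rw [Finset.sum_add_distrib, Finset.sum_const, Finset.card_univ, nsmul_eq_mul, ← hm]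
    ring
  rw [← hHav, ← hGav]
  refine Real.abs_circleAverage_le_circleAverage_abs.trans ?_
  exact Real.circleAverage_mono hHint.abs hGint hpt

/-! ### Erdős–Turán theorem for the zeros of a polynomial. -/

lemma exists_eq_univ_map {α : Type*} {n : ℕ} (s : Multiset α) (hs : Multiset.card s = n) :
    ∃ z : Fin n → α, s = Finset.univ.val.map z := by
  subst hs
  obtain ⟨l, rfl⟩ := Quot.exists_rep s
  exact ⟨l.get, ((Fin.univ_val_map _).trans (congrArg _ (List.ofFn_get l))).symm⟩

lemma sum_map_univ_map {α ι M : Type*} [Fintype ι] [AddCommMonoid M] (z : ι → α) (f : α → M) :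
    ((Finset.univ.val.map z).map f).sum = ∑ i, f (z i) := by
  rw [Multiset.map_map]; rfl

lemma norm_sub_div_norm {z : ℂ} (hz : z ≠ 0) : ‖z - z / ‖z‖‖ = |‖z‖ - 1| := by
  have h : ‖z‖ ≠ 0 := norm_ne_zero_iff.2 hz
  have h' : (‖z‖ : ℂ) ≠ 0 := Complex.ofReal_ne_zero.2 h
  have : z - z / ‖z‖ = z / ‖z‖ * ((‖z‖ - 1 : ℝ) : ℂ) := by
    push_cast
    field_simp
  rw [this, norm_mul, norm_div, Complex.norm_real, Complex.norm_real, norm_norm, div_self h,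
    one_mul, Real.norm_eq_abs]

/-- The cost of projecting a zero to the circle. The Lipschitz bound `|‖z‖ - 1|` is comparable to
`|log ‖z‖|` unless `‖z‖` is large, where the sup bound `2` takes over. -/
lemma abs_sub_div_norm_le {f : ℂ → ℝ} (hf : ∀ x y, |f x - f y| ≤ ‖x - y‖) (hf1 : ∀ x, |f x| ≤ 1)
    {z : ℂ} (hz : z ≠ 0) : |f z - f (z / ‖z‖)| ≤ 2 * |Real.log ‖z‖| := by
  have h : 0 < ‖z‖ := norm_pos_iff.2 hz
  have hA := hf z (z / ‖z‖)
  rw [norm_sub_div_norm hz] at hA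
  have hB : |f z - f (z / ‖z‖)| ≤ 2 := by
    refine (abs_sub _ _).trans ?_
    linarith [hf1 z, hf1 (z / ‖z‖)]
  rcases le_total ‖z‖ 1 with h1 | h1
  · have h2 := Real.log_le_sub_one_of_pos h
    rw [abs_of_nonpos (a := ‖z‖ - 1) (by linarith)] at hA
    rw [abs_of_nonpos (Real.log_nonpos h.le h1)]
    linarith
  · rw [abs_of_nonneg (a := ‖z‖ - 1) (by linarith)] at hA
    have h2 := Real.log_nonneg h1
    rw [abs_of_nonneg h2]
    rcases le_total (Real.log ‖z‖) 1 with h3 | h3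
    · have h4 : Real.exp (Real.log ‖z‖) ≤ 1 + Real.log ‖z‖ + Real.log ‖z‖ ^ 2 := by
        have := Real.abs_exp_sub_one_sub_id_le (x := Real.log ‖z‖) (by rwa [abs_of_nonneg h2])
        linarith [(abs_le.1 this).2]
      rw [Real.exp_log h] at h4
      nlinarith
    · linarith

/-- The difference of the two sides is exactly `(1 - ρ) ^ 2`. Multiplied over all zeros, it bounds
the polynomial of the projected zeros by `|P|` on the circle, normalized by `√(|p₀ p_m|)`. -/
lemma mul_norm_sub_sq_le {w ζ : ℂ} (hw : ‖w‖ = 1) (hζ : ‖ζ‖ = 1) (ρ : ℝ) :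
    ρ * ‖ζ - w‖ ^ 2 ≤ ‖ζ - ρ * w‖ ^ 2 := by
  have h1 : w.re * w.re + w.im * w.im = 1 := by
    rw [← Complex.normSq_apply, Complex.normSq_eq_norm_sq, hw]; norm_num
  have h2 : ζ.re * ζ.re + ζ.im * ζ.im = 1 := by
    rw [← Complex.normSq_apply, Complex.normSq_eq_norm_sq, hζ]; norm_num
  rw [← Complex.normSq_eq_norm_sq, ← Complex.normSq_eq_norm_sq]
  simp only [Complex.normSq_apply, Complex.sub_re, Complex.sub_im, Complex.mul_re, Complex.mul_im,
    Complex.ofReal_re, Complex.ofReal_im]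
  rw [← sub_nonneg]
  refine (sq_nonneg (1 - ρ)).trans (le_of_eq ?_)
  linear_combination (ρ - 1) * h2 + (ρ - ρ ^ 2) * h1

/-- A form of the Erdős–Turán theorem with bounded Lipschitz test functions. -/
theorem abs_sum_roots_sub_circleAverage_le {P : ℂ[X]} {δ : ℝ} (h0 : 0 < δ) (h1 : δ < 1)
    (hP0 : P.coeff 0 ≠ 0) (hdeg : 0 < P.natDegree)
    (hL : Real.log (erdosTuranRatio P) ≤ δ ^ 4 * P.natDegree)
    {f : ℂ → ℝ} (hf : ∀ x y, |f x - f y| ≤ ‖x - y‖) (hf1 : ∀ x, |f x| ≤ 1) :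
    |(P.natDegree : ℝ)⁻¹ * (P.roots.map f).sum - Real.circleAverage f 0 1| ≤ 40 * δ := by
  have hP : P ≠ 0 := fun h => hP0 (by simp [h])
  set m := P.natDegree with hm
  set S : ℝ := ∑ k ∈ Finset.range (m + 1), ‖P.coeff k‖ with hS
  set p0 : ℝ := ‖P.coeff 0‖ with hp0
  set pm : ℝ := ‖P.coeff m‖ with hpm
  have hp0' : 0 < p0 := norm_pos_iff.2 hP0
  have hpm' : 0 < pm := by
    rw [hpm, hm, coeff_natDegree]; exact norm_pos_iff.2 (leadingCoeff_ne_zero.2 hP)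
  have hSpos : 0 < S := hp0'.trans_le (Finset.single_le_sum
    (f := fun k => ‖P.coeff k‖) (fun _ _ => norm_nonneg _) (by simp))
  have hLdef : erdosTuranRatio P = S / √(p0 * pm) := rfl
  set Λ := erdosTuranRatio P with hΛ
  have hsq : 0 < √(p0 * pm) := Real.sqrt_pos.2 (mul_pos hp0' hpm')
  have hLpos : 0 < Λ := by rw [hLdef]; positivity
  have hcard : Multiset.card P.roots = m := (splits_iff_card_roots.1 (IsAlgClosed.splits P))
  obtain ⟨z, hz⟩ := exists_eq_univ_map P.roots hcard
  have hιm : (Fintype.card (Fin m) : ℝ) = m := by rw [Fintype.card_fin]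
  have hmR : (0 : ℝ) < m := by exact_mod_cast hdeg
  have heval : ∀ ζ, P.eval ζ = P.coeff m * ∏ i, (ζ - z i) := by
    intro ζ
    conv_lhs => rw [(IsAlgClosed.splits P).eq_prod_roots]
    rw [eval_mul, eval_C, coeff_natDegree, eval_multiset_prod, hz,
      Multiset.map_map, Multiset.map_map]
    simp [← Finset.prod_map_val]
  have hprod : p0 = pm * ∏ i, ‖z i‖ := by
    have := heval 0
    rw [← coeff_zero_eq_eval_zero] at this
    rw [hp0, this, norm_mul, norm_prod]
    simp [hpm]
  have hz0 : ∀ i, z i ≠ 0 := by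
    intro i hi
    have : ∏ i, ‖z i‖ = 0 := Finset.prod_eq_zero (Finset.mem_univ i) (by simp [hi])
    rw [this, mul_zero] at hprod
    exact hp0'.ne' hprod
  have hzn : ∀ i, 0 < ‖z i‖ := fun i => norm_pos_iff.2 (hz0 i)
  set w : Fin m → ℂ := fun i => z i / ‖z i‖ with hw
  have hwn : ∀ i, ‖w i‖ = 1 := fun i => by
    simp only [hw, norm_div, Complex.norm_real, norm_norm]
    exact div_self (hzn i).ne'
  have hsphere : ∀ ζ : ℂ, ‖ζ‖ = 1 → ∏ i, ‖1 - (starRingEnd ℂ) (w i) * ζ‖ ≤ Λ := by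
    intro ζ hζ
    have hPS : ‖P.eval ζ‖ ≤ S := by
      rw [eval_eq_sum_range]
      refine (norm_sum_le _ _).trans (Finset.sum_le_sum fun k _ => ?_)
      rw [norm_mul, norm_pow, hζ, one_pow, mul_one]
    have e1 : ∀ i, ‖1 - (starRingEnd ℂ) (w i) * ζ‖ = ‖ζ - w i‖ := by
      intro i
      have h3 : w i * (starRingEnd ℂ) (w i) = 1 := by
        simp [Complex.mul_conj, Complex.normSq_eq_norm_sq, hwn]
      have h4 : ζ - w i = -(w i * (1 - (starRingEnd ℂ) (w i) * ζ)) := by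
        linear_combination (-ζ) * h3
      rw [h4, norm_neg, norm_mul, hwn, one_mul]
    simp only [e1]
    rw [hLdef, le_div_iff₀ hsq]
    refine abs_le_of_sq_le_sq' ?_ hSpos.le |>.2
    rw [mul_pow, Real.sq_sqrt (by positivity), hprod]
    have h5 : (∏ i, ‖ζ - w i‖) ^ 2 * ∏ i, ‖z i‖ ≤ (∏ i, ‖ζ - z i‖) ^ 2 := by
      rw [← Finset.prod_pow, ← Finset.prod_pow, ← Finset.prod_mul_distrib]
      refine Finset.prod_le_prod (fun i _ => by positivity) fun i _ => ?_
      have h6 := mul_norm_sub_sq_le (hwn i) hζ ‖z i‖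
      have h7 : (‖z i‖ : ℂ) * w i = z i := by
        simp only [hw]
        exact mul_div_cancel₀ _ (Complex.ofReal_ne_zero.2 (hzn i).ne')
      rw [h7] at h6
      linarith
    calc (∏ i, ‖ζ - w i‖) ^ 2 * (pm * (∏ i, ‖z i‖) * pm)
        = pm ^ 2 * ((∏ i, ‖ζ - w i‖) ^ 2 * ∏ i, ‖z i‖) := by ring
      _ ≤ pm ^ 2 * (∏ i, ‖ζ - z i‖) ^ 2 := by gcongr
      _ = ‖P.eval ζ‖ ^ 2 := by rw [heval, norm_mul, norm_prod, mul_pow]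
      _ ≤ S ^ 2 := by gcongr
  -- The maximum principle carries the bound into the disc. The factor `2` only serves to make the
  -- inequality strict.
  have hdisc : ∀ ζ : ℂ, ‖ζ‖ < 1 →
      ∏ i, ‖1 - (starRingEnd ℂ) (w i) * ζ‖ < Real.exp (2 * δ ^ 4 * m) := by
    intro ζ hζ
    have h3 : ‖(fun ζ => ∏ i, (1 - (starRingEnd ℂ) (w i) * ζ)) ζ‖ ≤ Λ := by
      refine Complex.norm_le_of_forall_mem_frontier_norm_le
        (f := fun ζ => ∏ i, (1 - (starRingEnd ℂ) (w i) * ζ)) (U := Metric.ball (0 : ℂ) 1)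
        Metric.isBounded_ball ?_ ?_ (subset_closure (by simpa using hζ))
      · exact Differentiable.diffContOnCl (by fun_prop)
      · intro ξ hξ
        rw [frontier_ball _ one_ne_zero] at hξ
        simp only [norm_prod]
        exact hsphere ξ (by simpa using hξ)
    simp only [norm_prod] at h3
    refine h3.trans_lt ?_
    rw [← Real.log_lt_iff_lt_exp hLpos]
    have : 0 < δ ^ 4 * m := by positivity
    linarith
  have hang := abs_sum_sub_circleAverage_le hwn h0 h1 hdisc hf hf1
  -- Jensen's formula: the Mahler measure is at most the coefficient sum, which bounds `∑ log⁺ ‖z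
  -- i‖`. The product of the zeros gives `∑ log ‖z i‖`, and `|log| = 2 log⁺ - log`.
  have hlog : ∑ i, |Real.log ‖z i‖| ≤ 2 * Real.log Λ := by
    have hM : P.mahlerMeasure ≤ S := by
      refine (mahlerMeasure_le_sum_norm_coeff P).trans (le_of_eq ?_)
      rw [sum_over_range _ (by simp)]
    have h3 : Real.log pm + ∑ i, Real.posLog ‖z i‖ ≤ Real.log S := by
      have := Real.log_le_log (mahlerMeasure_pos_of_ne_zero hP) hM
      rw [← logMahlerMeasure_eq_log_MahlerMeasure,
        logMahlerMeasure_eq_log_leadingCoeff_add_sum_log_roots, hz, sum_map_univ_map] at this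
      rwa [← coeff_natDegree] at this
    have h4 : Real.log p0 = Real.log pm + ∑ i, Real.log ‖z i‖ := by
      rw [hprod, Real.log_mul hpm'.ne' (Finset.prod_pos fun i _ => hzn i).ne',
        Real.log_prod fun i _ => (hzn i).ne']
    have h5 : ∑ i, |Real.log ‖z i‖| = 2 * ∑ i, Real.posLog ‖z i‖ - ∑ i, Real.log ‖z i‖ := by
      rw [Finset.mul_sum, ← Finset.sum_sub_distrib]
      refine Finset.sum_congr rfl fun i _ => ?_
      rw [← Real.half_mul_log_add_log_abs]
      ring
    have h6 : Real.log Λ = Real.log S - (Real.log p0 + Real.log pm) / 2 := by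
      rw [hLdef, Real.log_div hSpos.ne' hsq.ne', Real.log_sqrt (by positivity),
        Real.log_mul hp0'.ne' hpm'.ne']
    linarith
  have hrad : |∑ i, f (z i) - ∑ i, f (w i)| ≤ 4 * δ ^ 4 * m := by
    rw [← Finset.sum_sub_distrib]
    refine (Finset.abs_sum_le_sum_abs _ _).trans ?_
    refine (Finset.sum_le_sum fun i _ => abs_sub_div_norm_le hf hf1 (hz0 i)).trans ?_
    rw [← Finset.mul_sum]
    linarith
  have hsum : (P.roots.map f).sum = ∑ i, f (z i) := by
    rw [hz, sum_map_univ_map]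
  rw [hsum]
  rw [hιm] at hang
  have htot : |∑ i, f (z i) - m * Real.circleAverage f 0 1| ≤ 40 * δ * m := by
    have h8 : ∑ i, f (z i) - m * Real.circleAverage f 0 1 =
      (∑ i, f (z i) - ∑ i, f (w i)) + (∑ i, f (w i) - m * Real.circleAverage f 0 1) := by ring
    rw [h8]
    refine (abs_add_le _ _).trans ((add_le_add hrad hang).trans ?_)
    have h9 : 8 * (2 * δ ^ 4 * m) / δ ^ 2 = 16 * δ ^ 2 * m := by field_simp; ring
    rw [h9]
    have h10 : δ ^ 2 ≤ δ := by nlinarith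
    have h11 : δ ^ 4 ≤ δ := by nlinarith [sq_nonneg δ]
    have h12 : 4 * δ ^ 4 + (3 / 2 * δ + 16 * δ ^ 2) ≤ 40 * δ := by linarith
    nlinarith
  have h13 : (m : ℝ)⁻¹ * ∑ i, f (z i) - Real.circleAverage f 0 1 =
      (m : ℝ)⁻¹ * (∑ i, f (z i) - m * Real.circleAverage f 0 1) := by
    field_simp
  rw [h13, abs_mul, abs_of_pos (inv_pos.2 hmR), inv_mul_le_iff₀ hmR]
  linarith

/-! ### Passage to the bounded Lipschitz metric. -/

lemma abs_le_one_of_norms_le {f : ℂ → ℝ} (h : lipNorm f + uniformNorm f ≤ 1) (x : ℂ) :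
    |f x| ≤ 1 := by
  have h1 : ‖f x‖ₑ ≤ 1 :=
    ((le_iSup (fun x => ‖f x‖ₑ) x).trans le_add_self).trans h
  simpa [enorm_le_iff_norm_le, ← ofReal_norm] using h1

lemma abs_sub_le_of_norms_le {f : ℂ → ℝ} (h : lipNorm f + uniformNorm f ≤ 1) (x y : ℂ) :
    |f x - f y| ≤ ‖x - y‖ := by
  have h1 : edist (f x) (f y) / edist x y ≤ 1 :=
    ((le_iSup₂ (f := fun x y => edist (f x) (f y) / edist x y) x y).trans le_self_add).trans h
  have h2 : edist (f x) (f y) ≤ edist x y := by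
    rcases eq_or_ne x y with rfl | hxy
    · simp
    · have := (ENNReal.div_le_iff (edist_pos.2 hxy).ne' (edist_ne_top _ _)).1 h1
      simpa using this
  rw [edist_dist, edist_dist, ENNReal.ofReal_le_ofReal_iff dist_nonneg] at h2
  simpa [Real.dist_eq, dist_eq_norm] using h2

lemma integral_multiset_sum_dirac (f : ℂ → ℝ) (s : Multiset ℂ) :
    Integrable f (s.map Measure.dirac).sum ∧
      ∫ z, f z ∂(s.map Measure.dirac).sum = (s.map f).sum := by
  induction s using Multiset.induction with
  | empty => simp
  | cons a s ih =>
    have ha : Integrable f (Measure.dirac a) := integrable_dirac (by simp)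
    rw [Multiset.map_cons, Multiset.sum_cons, Multiset.map_cons, Multiset.sum_cons]
    refine ⟨ha.add_measure ih.1, ?_⟩
    rw [integral_add_measure ha ih.1, ih.2, integral_dirac]

lemma integral_zeroMeasure (f : ℂ → ℝ) (P : ℂ[X]) :
    ∫ z, f z ∂(zeroMeasure P) = (P.natDegree : ℝ)⁻¹ * (P.roots.map f).sum := by
  rw [zeroMeasure, integral_smul_measure, (integral_multiset_sum_dirac f _).2]
  simp

lemma integral_uniformCircle {f : ℂ → ℝ} (hf : Continuous f) :
    ∫ z, f z ∂uniformCircle = Real.circleAverage f 0 1 := by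
  rw [uniformCircle, integral_smul_measure,
    integral_map (by fun_prop) hf.aestronglyMeasurable, Real.circleAverage,
    intervalIntegral.integral_of_le Real.two_pi_pos.le, ENNReal.toReal_inv,
    ENNReal.toReal_ofReal Real.two_pi_pos.le]

theorem dBL_zeroMeasure_uniformCircle_le {P : ℂ[X]} {δ : ℝ} (h0 : 0 < δ) (h1 : δ < 1)
    (hP0 : P.coeff 0 ≠ 0) (hdeg : 0 < P.natDegree)
    (hL : Real.log (erdosTuranRatio P) ≤ δ ^ 4 * P.natDegree) :
    dBL (zeroMeasure P) uniformCircle ≤ 40 * δ := by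
  refine Real.sSup_le ?_ (by positivity)
  rintro r ⟨f, hfn, rfl⟩
  have hlip := abs_sub_le_of_norms_le hfn
  have hfc : Continuous f := by
    refine LipschitzWith.continuous (K := 1) (LipschitzWith.of_dist_le_mul fun x y => ?_)
    simpa [Real.dist_eq, dist_eq_norm] using hlip x y
  rw [integral_zeroMeasure f, integral_uniformCircle hfc]
  exact abs_sum_roots_sub_circleAverage_le h0 h1 hP0 hdeg hL hlip (abs_le_one_of_norms_le hfn)

/-! ### Deterministic bound for Padé numerators. -/

/-- The `k × k` Toeplitz matrix of the sequence `b` with `b m` on the diagonal. -/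
def toeplitz (b : ℕ → ℝ) (m k : ℕ) : Matrix (Fin k) (Fin k) ℂ :=
  Matrix.of fun i j => (b (m + i - j) : ℂ)

lemma norm_det_le {n : ℕ} (A : Matrix (Fin n) (Fin n) ℂ) {B : ℝ} (h : ∀ i j, ‖A i j‖ ≤ B) :
    ‖A.det‖ ≤ n.factorial * B ^ n := by
  have := Matrix.det_le (abv := NormedField.toAbsoluteValue ℂ) (A := A) (x := B) h
  rw [Fintype.card_fin, nsmul_eq_mul] at this
  exact this

lemma coeff_mul_eq_sum_range {f : PowerSeries ℂ} {b : ℕ → ℝ} {k : ℕ}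
    (hb : ∀ j ≤ k, PowerSeries.coeff j f = b j) (Q : ℂ[X]) :
    PowerSeries.coeff k (f * (Q : PowerSeries ℂ)) =
      ∑ l ∈ Finset.range (k + 1), Q.coeff l * b (k - l) := by
  rw [mul_comm, PowerSeries.coeff_mul, Finset.Nat.sum_antidiagonal_eq_sum_range_succ_mk]
  refine Finset.sum_congr rfl fun l _ => ?_
  rw [hb _ (Nat.sub_le _ _), Polynomial.coeff_coe]

lemma toeplitz_submatrix_succ (b : ℕ → ℝ) (m n : ℕ) :
    (toeplitz b m (n + 1)).submatrix Fin.succ Fin.succ = toeplitz b m n := by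
  ext i j
  simp only [toeplitz, Matrix.submatrix_apply, Matrix.of_apply, Fin.val_succ]
  congr 2
  omega

/-- Cramer's rule for the denominator of a Padé approximant. -/
lemma det_toeplitz_mul_coeff {f : PowerSeries ℂ} {b : ℕ → ℝ} {m n : ℕ} (hnm : n ≤ m)
    (hb : ∀ j ≤ m + n, PowerSeries.coeff j f = b j) {P Q : ℂ[X]} (h : IsPadePair f m n P Q)
    (l : Fin (n + 1)) :
    (toeplitz b m (n + 1)).det * Q.coeff l =
      P.coeff m * (toeplitz b m (n + 1)).adjugate l 0 := by
  set T := toeplitz b m (n + 1) with hT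
  -- Row `i` is the Padé equation of order `m + i`: order `m` yields `p_m`, and higher orders yield
  -- `0` because `deg P ≤ m`. As `n ≤ m`, the natural subtraction in `toeplitz` does not truncate
  -- here.
  have key : T.mulVec (fun l => Q.coeff l) = Pi.single 0 (P.coeff m) := by
    funext i
    have hi : m + (i : ℕ) ≤ m + n := by omega
    have h1 := h.coeff_eq_zero _ hi
    rw [map_sub, sub_eq_zero, coeff_mul_eq_sum_range (fun j hj => hb j (hj.trans hi)),
      Polynomial.coeff_coe] at h1
    have h2 : T.mulVec (fun l => Q.coeff l) i = P.coeff (m + i) := by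
      rw [← h1]
      refine (Fin.sum_univ_eq_sum_range (fun j => (b (m + i - j) : ℂ) * Q.coeff j) (n + 1)).trans ?_
      have hsub : Finset.range (n + 1) ⊆ Finset.range (m + i + 1) :=
        Finset.range_subset_range.2 (by omega)
      rw [← Finset.sum_subset hsub]
      · exact Finset.sum_congr rfl fun _ _ => mul_comm _ _
      · intro j _ hj
        rw [coeff_eq_zero_of_natDegree_lt, zero_mul]
        have := h.natDegree_den_le
        simp only [Finset.mem_range, not_lt] at hj
        omega
    rw [h2]
    by_cases hi0 : i = 0
    · subst hi0; simp
    · rw [Pi.single_eq_of_ne hi0, coeff_eq_zero_of_natDegree_lt]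
      have := h.natDegree_num_le
      have : (i : ℕ) ≠ 0 := fun h => hi0 (Fin.ext h)
      omega
  have h3 := congrArg (fun v => T.adjugate.mulVec v l) key
  simp only [Matrix.mulVec_mulVec, Matrix.adjugate_mul, Matrix.smul_mulVec, Matrix.one_mulVec,
    Matrix.mulVec_single, Pi.smul_apply, smul_eq_mul] at h3
  rw [h3]
  simp [Matrix.col_apply, mul_comm]

/-- A deterministic bound for the Erdős–Turán ratio of a Padé numerator. -/
theorem erdosTuranRatio_le {f : PowerSeries ℂ} {b : ℕ → ℝ} {m n : ℕ} (hnm : n ≤ m)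
    (hb : ∀ j ≤ m + n, PowerSeries.coeff j f = b j) {S : ℝ}
    (hS : ∑ j ∈ Finset.range (m + n + 1), |b j| ≤ S) (hb0 : b 0 ≠ 0)
    (hD : (toeplitz b m n).det ≠ 0) (hD' : (toeplitz b m (n + 1)).det ≠ 0) {P : ℂ[X]}
    (h : IsPadeNumerator f m n P) :
    P.coeff 0 ≠ 0 ∧ P.coeff m ≠ 0 ∧ P.natDegree = m ∧
      erdosTuranRatio P ≤ (m + 1) * S * (n.factorial * S ^ n) /
        √(‖(toeplitz b m n).det‖ * ‖(toeplitz b m (n + 1)).det‖ * |b 0|) := by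
  obtain ⟨Q, hPQ⟩ := h
  set T := toeplitz b m (n + 1) with hT
  set D := (toeplitz b m n).det with hDdef
  have hcr := det_toeplitz_mul_coeff hnm hb hPQ
  rw [← hT] at hcr
  have hadj : ∀ i j, T.adjugate i j = (-1) ^ (j + i : ℕ) *
      (T.submatrix j.succAbove i.succAbove).det := fun i j =>
    Matrix.adjugate_fin_succ_eq_det_submatrix T i j
  have hbS : ∀ j ≤ m + n, |b j| ≤ S := fun j hj =>
    (Finset.single_le_sum (f := fun j => |b j|) (fun _ _ => abs_nonneg _)
      (Finset.mem_range.2 (by omega))).trans hS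
  have hS0 : 0 < S := (abs_pos.2 hb0).trans_le (hbS 0 (by omega))
  set A : ℝ := n.factorial * S ^ n with hA
  have hA0 : 0 < A := by positivity
  have hadjn : ∀ i, ‖T.adjugate i 0‖ ≤ A := by
    intro i
    rw [hadj, norm_mul, norm_pow, norm_neg, norm_one, one_pow, one_mul]
    refine norm_det_le _ fun k l => ?_
    simp only [hT, toeplitz, Matrix.submatrix_apply, Matrix.of_apply, Complex.norm_real,
      Real.norm_eq_abs]
    exact hbS _ (by omega)
  have hadj0 : T.adjugate 0 0 = D := by
    rw [hadj]
    simp only [Fin.val_zero, add_zero, pow_zero, one_mul, hDdef]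
    rw [← toeplitz_submatrix_succ]
    rfl
  have hq : ∀ l, Q.coeff l ≠ 0 → l < n + 1 := fun l hl => by
    have := le_natDegree_of_ne_zero hl
    have := hPQ.natDegree_den_le
    omega
  -- If `p_m = 0`, the nonsingular system would force `Q = 0`.
  have hpm : P.coeff m ≠ 0 := by
    intro h0
    apply hPQ.den_ne_zero
    ext l
    by_contra hl
    have := hcr ⟨l, hq l hl⟩
    rw [h0, zero_mul] at this
    exact (mul_ne_zero hD' hl) this
  have hq0 : T.det * Q.coeff 0 = P.coeff m * D := by
    have := hcr 0
    rwa [hadj0] at this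
  have hcoeff : ∀ k ≤ m, P.coeff k = ∑ l ∈ Finset.range (k + 1), Q.coeff l * b (k - l) := by
    intro k hk
    have h1 := hPQ.coeff_eq_zero k (by omega)
    rw [map_sub, sub_eq_zero, coeff_mul_eq_sum_range (fun j hj => hb j (by omega)),
      Polynomial.coeff_coe] at h1
    exact h1.symm
  have hp0 : P.coeff 0 = Q.coeff 0 * b 0 := by
    rw [hcoeff 0 (by omega)]; simp
  have hQ0 : Q.coeff 0 ≠ 0 := by
    intro h0
    rw [h0, mul_zero] at hq0
    exact mul_ne_zero hpm hD hq0.symm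
  have hp0' : P.coeff 0 ≠ 0 := by
    rw [hp0]; exact mul_ne_zero hQ0 (Complex.ofReal_ne_zero.2 hb0)
  have hdeg : P.natDegree = m := le_antisymm hPQ.natDegree_num_le (le_natDegree_of_ne_zero hpm)
  refine ⟨hp0', hpm, hdeg, ?_⟩
  have hd' : 0 < ‖T.det‖ := norm_pos_iff.2 hD'
  have hd : 0 < ‖D‖ := norm_pos_iff.2 hD
  have hpmn : 0 < ‖P.coeff m‖ := norm_pos_iff.2 hpm
  have hb0' : 0 < |b 0| := abs_pos.2 hb0
  have hqn : ∀ l, ‖Q.coeff l‖ ≤ ‖P.coeff m‖ * A / ‖T.det‖ := by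
    intro l
    by_cases hl : Q.coeff l = 0
    · rw [hl, norm_zero]; positivity
    · rw [le_div_iff₀ hd', mul_comm, ← norm_mul]
      have := hcr ⟨l, hq l hl⟩
      simp only at this
      rw [this, norm_mul]
      exact mul_le_mul_of_nonneg_left (hadjn _) (norm_nonneg _)
  have hpk : ∀ k ≤ m, ‖P.coeff k‖ ≤ ‖P.coeff m‖ * A / ‖T.det‖ * S := by
    intro k hk
    rw [hcoeff k hk]
    calc _ ≤ ∑ l ∈ Finset.range (k + 1), ‖P.coeff m‖ * A / ‖T.det‖ * |b (k - l)| := by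
          refine norm_sum_le_of_le _ fun l _ => ?_
          rw [norm_mul, Complex.norm_real, Real.norm_eq_abs]
          exact mul_le_mul_of_nonneg_right (hqn l) (abs_nonneg _)
      _ = ‖P.coeff m‖ * A / ‖T.det‖ * ∑ l ∈ Finset.range (k + 1), |b l| := by
          rw [← Finset.mul_sum]
          congr 1
          exact Finset.sum_range_reflect (fun l => |b l|) (k + 1)
      _ ≤ _ := by
          gcongr
          refine le_trans ?_ hS
          exact Finset.sum_le_sum_of_subset_of_nonneg
            (Finset.range_subset_range.2 (by omega)) fun _ _ _ => abs_nonneg _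
  have hsum : ∑ k ∈ Finset.range (m + 1), ‖P.coeff k‖ ≤
      (m + 1) * (‖P.coeff m‖ * A / ‖T.det‖ * S) := by
    refine (Finset.sum_le_card_nsmul _ _ _ fun k hk =>
      hpk k (by simpa [Nat.lt_succ_iff] using hk)).trans (le_of_eq ?_)
    simp
  have hp0n : ‖P.coeff 0‖ = ‖P.coeff m‖ * ‖D‖ * |b 0| / ‖T.det‖ := by
    rw [eq_div_iff hd'.ne', hp0, ← norm_mul, norm_mul, norm_mul, Complex.norm_real,
      Real.norm_eq_abs, mul_right_comm, ← norm_mul, mul_comm (Q.coeff 0), hq0,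
      norm_mul]
  have hsqrt : √(‖P.coeff 0‖ * ‖P.coeff m‖) =
      ‖P.coeff m‖ / ‖T.det‖ * √(‖D‖ * ‖T.det‖ * |b 0|) := by
    rw [hp0n, ← Real.sqrt_sq (show 0 ≤ ‖P.coeff m‖ / ‖T.det‖ by positivity),
      ← Real.sqrt_mul (by positivity)]
    congr 1
    field_simp
  rw [erdosTuranRatio, hdeg, hsqrt]
  have hs : 0 < √(‖D‖ * ‖T.det‖ * |b 0|) := Real.sqrt_pos.2 (by positivity)
  rw [div_le_div_iff₀ (by positivity) hs]
  refine (mul_le_mul_of_nonneg_right hsum hs.le).trans (le_of_eq ?_)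
  field_simp

/-! ### Small ball and moment estimates. -/

/-- A monic complex polynomial of degree `k` is at least `ε ^ k` at distance `ε` from the real
parts of its roots. -/
lemma exists_root_of_norm_eval_lt {p : ℂ[X]} (hp : p.Monic) {ε x : ℝ} (hε : 0 ≤ ε)
    (h : ‖p.eval (x : ℂ)‖ < ε ^ p.natDegree) : ∃ z ∈ p.roots.toFinset, |x - z.re| < ε := by
  by_contra! hcon
  have hcard := splits_iff_card_roots.1 (IsAlgClosed.splits p)
  rw [← hcard] at h
  have hev : p.eval (x : ℂ) = (p.roots.map fun z => (x : ℂ) - z).prod := by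
    conv_lhs => rw [(IsAlgClosed.splits p).eq_prod_roots, hp.leadingCoeff]
    simp [eval_multiset_prod, Multiset.map_map]
  rw [hev] at h
  refine absurd h (not_lt.2 ?_)
  have : ∀ s : Multiset ℂ, (∀ z ∈ s, ε ≤ |x - z.re|) →
      ε ^ Multiset.card s ≤ ‖(s.map fun z => (x : ℂ) - z).prod‖ := by
    intro s
    induction s using Multiset.induction with
    | empty => simp
    | cons a s ih =>
      intro hs
      rw [Multiset.card_cons, pow_succ', Multiset.map_cons, Multiset.prod_cons, norm_mul]
      have h1 : ε ≤ ‖(x : ℂ) - a‖ := by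
        refine (hs a (Multiset.mem_cons_self a s)).trans ?_
        have := Complex.abs_re_le_norm ((x : ℂ) - a)
        simpa using this
      exact mul_le_mul h1 (ih fun z hz => hs z (Multiset.mem_cons_of_mem hz)) (by positivity)
        (norm_nonneg _)
  exact this _ fun z hz => hcon z (by simpa using hz)

/-- Small ball estimate for a characteristic polynomial at an independent random point. -/
lemma measure_norm_eval_charpoly_lt_le {Ω E : Type*} [MeasurableSpace Ω] [MeasurableSpace E]
    {μ : Measure Ω} [IsProbabilityMeasure μ] {ξ : Ω → ℝ} {Y : Ω → E} (hξ : Measurable ξ)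
    (hY : Measurable Y) (hind : IndepFun ξ Y μ) {k : ℕ} {M : E → Matrix (Fin k) (Fin k) ℂ}
    (hM : ∀ i j, Measurable fun y => M y i j) {ε : ℝ} (hε : 0 ≤ ε) {c : ℝ≥0∞}
    (hc : ∀ t : ℝ, μ {ω | |ξ ω - t| < ε} ≤ c) :
    μ {ω | ‖(M (Y ω)).charpoly.eval (ξ ω : ℂ)‖ < ε ^ k} ≤ k * c := by
  set s : Set (ℝ × E) := {p | ‖(M p.2).charpoly.eval (p.1 : ℂ)‖ < ε ^ k} with hs
  have hsm : MeasurableSet s := by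
    refine measurableSet_lt (Measurable.norm ?_) measurable_const
    simp only [Matrix.eval_charpoly, Matrix.det_apply']
    refine Finset.measurable_sum _ fun σ _ => Measurable.mul measurable_const ?_
    refine Finset.measurable_prod _ fun i _ => ?_
    simp only [Matrix.sub_apply, Matrix.scalar_apply, Matrix.diagonal_apply]
    refine Measurable.sub ?_ ((hM _ _).comp measurable_snd)
    split_ifs
    · fun_prop
    · fun_prop
  have h1 : μ {ω | ‖(M (Y ω)).charpoly.eval (ξ ω : ℂ)‖ < ε ^ k} =
      ((μ.map ξ).prod (μ.map Y)) s := by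
    rw [← (indepFun_iff_map_prod_eq_prod_map_map hξ.aemeasurable hY.aemeasurable).1 hind,
      Measure.map_apply (hξ.prodMk hY) hsm]
    rfl
  have : IsProbabilityMeasure (μ.map ξ) := Measure.isProbabilityMeasure_map hξ.aemeasurable
  have : IsProbabilityMeasure (μ.map Y) := Measure.isProbabilityMeasure_map hY.aemeasurable
  rw [h1, Measure.prod_apply_symm hsm]
  -- By Fubini the matrix may be frozen. The bad set of `x` is then covered by intervals around the
  -- real parts of at most `k` roots.
  have h2 : ∀ y, (μ.map ξ) ((fun x => (x, y)) ⁻¹' s) ≤ k * c := by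
    intro y
    set p := (M y).charpoly with hp
    have hdeg : p.natDegree = k := by
      rw [hp, Matrix.charpoly_natDegree_eq_dim, Fintype.card_fin]
    have hsub : ((fun x => (x, y)) ⁻¹' s) ⊆
        ⋃ z ∈ p.roots.toFinset, {x : ℝ | |x - z.re| < ε} := by
      intro x hx
      have hx' : ‖p.eval (x : ℂ)‖ < ε ^ p.natDegree := by rw [hdeg]; exact hx
      obtain ⟨z, hz, hzx⟩ := exists_root_of_norm_eval_lt (Matrix.charpoly_monic _) hε hx'
      exact Set.mem_biUnion hz hzx
    have hball : ∀ t : ℝ, (μ.map ξ) {x | |x - t| < ε} ≤ c := by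
      intro t
      rw [Measure.map_apply hξ (measurableSet_lt (by fun_prop) measurable_const)]
      exact hc t
    calc _ ≤ ∑ z ∈ p.roots.toFinset, (μ.map ξ) {x : ℝ | |x - z.re| < ε} :=
          (measure_mono hsub).trans (measure_biUnion_finset_le _ _)
      _ ≤ p.roots.toFinset.card • c := Finset.sum_le_card_nsmul _ _ _ fun z _ => hball _
      _ ≤ k * c := by
          rw [nsmul_eq_mul]
          gcongr
          exact (Multiset.toFinset_card_le _).trans ((card_roots' _).trans hdeg.le)
  calc _ ≤ ∫⁻ _, (k * c) ∂(μ.map Y) := lintegral_mono h2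
    _ = k * c := by simp

/-- The extension by zero of a finite sequence. -/
def extendZero {N : ℕ} (c : Fin (N + 1) → ℝ) (k : ℕ) : ℝ :=
  if h : k < N + 1 then c ⟨k, h⟩ else 0

lemma coeff_polyOfCoeffs {N : ℕ} (c : Fin (N + 1) → ℝ) (k : ℕ) :
    PowerSeries.coeff k (polyOfCoeffs c : PowerSeries ℂ) = extendZero c k := by
  rw [Polynomial.coeff_coe, polyOfCoeffs, finsetSum_coeff]
  simp only [coeff_C_mul, coeff_X_pow]
  unfold extendZero
  split_ifs with h
  · rw [Finset.sum_eq_single (⟨k, h⟩ : Fin (N + 1))]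
    · simp
    · intro j _ hj
      have : k ≠ j := fun h => hj (Fin.ext h.symm)
      simp [this]
    · simp
  · rw [Finset.sum_eq_zero]
    · simp
    · intro j _
      have : k ≠ j := by have := j.2; omega
      simp [this]

/-- The Toeplitz determinant is the characteristic polynomial, at `a_m`, of minus its off-diagonal
part. Since `k ≤ m + 1` excludes truncated indices, that part does not involve `a_m` and is
independent of it. -/
lemma measure_norm_det_toeplitz_lt_le {Ω : Type*} [MeasurableSpace Ω] {μ : Measure Ω}
    [IsProbabilityMeasure μ] {N : ℕ} {a : Fin (N + 1) → Ω → ℝ} (ha : ∀ j, Measurable (a j))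
    (hind : iIndepFun a μ) {m k : ℕ} (hm : m < N + 1) (hk : k ≤ m + 1) {ε : ℝ} (hε : 0 ≤ ε)
    {c : ℝ≥0∞} (hc : ∀ t : ℝ, μ {ω | |a ⟨m, hm⟩ ω - t| < ε} ≤ c) :
    μ {ω | ‖(toeplitz (extendZero fun j => a j ω) m k).det‖ < ε ^ k} ≤ k * c := by
  set jm : Fin (N + 1) := ⟨m, hm⟩ with hjm
  set T : Finset (Fin (N + 1)) := Finset.univ.erase jm with hT
  have hY : Measurable fun ω (i : T) => a i ω := measurable_pi_lambda _ fun i => ha i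
  have hI : IndepFun (a jm) (fun ω (i : T) => a i ω) μ := by
    have h1 := hind.indepFun_finset {jm} T (by simp [hT]) ha
    exact h1.comp (φ := fun x : (({jm} : Finset (Fin (N + 1))) → ℝ) => x ⟨jm, by simp⟩)
      (ψ := id) (measurable_pi_apply _) measurable_id
  set M : (T → ℝ) → Matrix (Fin k) (Fin k) ℂ := fun y => Matrix.of fun i j =>
    if h : ∃ h : m + i - j < N + 1, (⟨m + i - j, h⟩ : Fin (N + 1)) ∈ T then
      -(y ⟨⟨m + i - j, h.1⟩, h.2⟩ : ℂ) else 0 with hMdef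
  have hM : ∀ i j, Measurable fun y => M y i j := by
    intro i j
    simp only [hMdef, Matrix.of_apply]
    split_ifs with h
    · fun_prop
    · fun_prop
  have key := measure_norm_eval_charpoly_lt_le (ha jm) hY hI hM hε hc
  convert key using 6 with ω
  rw [Matrix.eval_charpoly]
  congr 1
  ext i j
  simp only [toeplitz, extendZero, hMdef, Matrix.of_apply, Matrix.sub_apply, Matrix.scalar_apply,
    Matrix.diagonal_apply]
  have hi := i.2
  have hj := j.2
  by_cases hij : i = j
  · subst hij
    have e : m + (i : ℕ) - i = m := by omega
    have : ¬ ∃ h : m + (i : ℕ) - i < N + 1, (⟨m + i - i, h⟩ : Fin (N + 1)) ∈ T := by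
      simp [hT, hjm]
    rw [dif_neg this, if_pos rfl, sub_zero]
    simp [hm, hjm]
  · have hne : (i : ℕ) ≠ j := fun h => hij (Fin.ext h)
    rw [if_neg hij]
    by_cases hN : m + (i : ℕ) - j < N + 1
    · have hmem : ∃ h : m + (i : ℕ) - j < N + 1, (⟨m + i - j, h⟩ : Fin (N + 1)) ∈ T := by
        refine ⟨hN, ?_⟩
        simp only [hT, hjm, Finset.mem_erase, Finset.mem_univ, and_true, ne_eq, Fin.mk.injEq]
        omega
      rw [dif_pos hN, dif_pos hmem]
      simp
    · have hmem : ¬ ∃ h : m + (i : ℕ) - j < N + 1, (⟨m + i - j, h⟩ : Fin (N + 1)) ∈ T :=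
        fun h => hN h.1
      rw [dif_neg hN, dif_neg hmem]
      simp

/-- Markov's inequality for the `ℓ¹` norm of an isotropic vector. -/
lemma measure_sum_abs_ge_le {Ω : Type*} [MeasurableSpace Ω] {μ : Measure Ω}
    [IsProbabilityMeasure μ] {N : ℕ} {a : Fin (N + 1) → Ω → ℝ} (hiso : IsIsotropic μ a)
    (r : ℕ) {R : ℝ} (hR : 0 < R) :
    μ {ω | R ≤ ∑ j ∈ Finset.range r, |extendZero (fun j => a j ω) j|} ≤ ENNReal.ofReal (r / R) := by
  have hint : ∀ j, Integrable (fun ω => |extendZero (fun j => a j ω) j|) μ ∧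
      ∫ ω, |extendZero (fun j => a j ω) j| ∂μ ≤ 1 := by
    intro j
    unfold extendZero
    by_cases h : j < N + 1
    · simp only [dif_pos h]
      set ξ := a ⟨j, h⟩
      have h2 : MemLp ξ 2 μ := hiso.memLp _
      have hi : Integrable ξ μ := h2.integrable (by norm_num)
      have hsq : ∫ ω, ξ ω ^ 2 ∂μ = 1 := by
        have h3 := hiso.covariance_eq ⟨j, h⟩ ⟨j, h⟩
        rw [if_pos rfl, covariance_self hi.aemeasurable, variance_eq_sub h2] at h3
        simpa [hiso.centered, ξ] using h3
      refine ⟨hi.abs, ?_⟩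
      calc ∫ ω, |ξ ω| ∂μ ≤ ∫ ω, (ξ ω ^ 2 + 1) / 2 ∂μ := by
            refine integral_mono hi.abs ((h2.integrable_sq.add (integrable_const _)).div_const _)
              fun ω => ?_
            have := sq_nonneg (|ξ ω| - 1)
            rw [sub_sq, sq_abs] at this
            simp only
            linarith
        _ = 1 := by
            rw [integral_div, integral_add h2.integrable_sq (integrable_const _), hsq]
            simp
    · simp only [dif_neg h]
      simp
  set g : Ω → ℝ := fun ω => ∑ j ∈ Finset.range r, |extendZero (fun j => a j ω) j| with hg
  have hgi : Integrable g μ := integrable_finsetSum _ fun j _ => (hint j).1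
  have hgle : ∫ ω, g ω ∂μ ≤ r := by
    rw [hg, integral_finsetSum _ fun j _ => (hint j).1]
    refine (Finset.sum_le_card_nsmul _ _ 1 fun j _ => (hint j).2).trans (by simp)
  have hmk := mul_meas_ge_le_integral_of_nonneg
    (Filter.Eventually.of_forall fun ω => Finset.sum_nonneg fun j _ => abs_nonneg _) hgi R
  rw [← ofReal_measureReal]
  refine ENNReal.ofReal_le_ofReal ?_
  rw [le_div_iff₀ hR, mul_comm]
  exact hmk.trans hgle

/-! ### Choice of constants and conclusion. -/

/-- In the variable `y = m δ⁴ / n` the hypothesis reads `y ≥ 100 Λ`. The left side is at most `n (22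
Λ + 3y/16 + 3)`, the `y/16` coming from `log y ≤ y/16 + 2`; this is below `n y`. -/
lemma log_ratio_bound_le {m n : ℕ} {K δ : ℝ} (hn : 1 ≤ n) (hK : 1 ≤ K) (h0 : 0 < δ) (h1 : δ < 1)
    (hmn : 100 * (δ ^ 4)⁻¹ * n * Real.log (Real.exp 1 * K * n / δ) ≤ m) :
    n ≤ m ∧ (n + 2) * Real.log (24 * m / δ) + n * Real.log n +
      (n + 1) * Real.log (16 * n * K / δ) ≤ δ ^ 4 * m := by
  have hn' : (1 : ℝ) ≤ n := by exact_mod_cast hn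
  have hn0 : (0 : ℝ) < n := by linarith
  have hK0 : 0 < K := by linarith
  set Λ := Real.log (Real.exp 1 * K * n / δ) with hΛ
  have hΛe : Λ = 1 + Real.log K + Real.log n - Real.log δ := by
    rw [hΛ, Real.log_div (by positivity) h0.ne', Real.log_mul (by positivity) hn0.ne',
      Real.log_mul (by positivity) hK0.ne', Real.log_exp]
  have hlK := Real.log_nonneg hK
  have hln := Real.log_nonneg hn'
  have hlδ := Real.log_nonpos h0.le h1.le
  have hΛ1 : 1 ≤ Λ := by linarith
  have hd4 : 0 < δ ^ 4 := by positivity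
  have hd41 : δ ^ 4 ≤ 1 := pow_le_one₀ h0.le h1.le
  set y : ℝ := m * δ ^ 4 / n with hy
  have hyΛ : 100 * Λ ≤ y := by
    rw [hy, le_div_iff₀ hn0]
    have := mul_le_mul_of_nonneg_right hmn hd4.le
    field_simp at this
    linarith
  have hy0 : 0 < y := by linarith
  have hmy : (m : ℝ) = y * n / δ ^ 4 := by rw [hy]; field_simp
  have hnm : (n : ℝ) ≤ m := by
    rw [hmy, le_div_iff₀ hd4]
    nlinarith
  refine ⟨by exact_mod_cast hnm, ?_⟩
  have hm0 : (0 : ℝ) < m := by linarith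
  have l2 := Real.log_two_lt_d9
  have hl16 : Real.log 16 ≤ 3 := by
    rw [show (16 : ℝ) = 2 ^ 4 by norm_num, Real.log_pow]; push_cast; linarith
  have hl24 : Real.log 24 ≤ 4 := by
    have : Real.log 24 ≤ Real.log (2 ^ 5) := Real.log_le_log (by norm_num) (by norm_num)
    rw [Real.log_pow] at this; push_cast at this; linarith
  have hly : Real.log y ≤ y / 16 + 2 := by
    have := Real.log_le_sub_one_of_pos (show 0 < y / 16 by positivity)
    rw [Real.log_div hy0.ne' (by norm_num)] at this
    linarith
  have e1 : Real.log (24 * m / δ) = Real.log 24 + Real.log y + Real.log n - 5 * Real.log δ := by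
    rw [hmy, Real.log_div (by positivity) h0.ne', Real.log_mul (by norm_num) (by positivity),
      Real.log_div (by positivity) hd4.ne', Real.log_mul hy0.ne' hn0.ne', Real.log_pow]
    push_cast; ring
  have e2 : Real.log (16 * n * K / δ) =
      Real.log 16 + Real.log n + Real.log K - Real.log δ := by
    rw [Real.log_div (by positivity) h0.ne', Real.log_mul (by positivity) hK0.ne',
      Real.log_mul (by norm_num) hn0.ne']
  have b1 : Real.log (24 * m / δ) ≤ 5 * Λ + y / 16 + 1 := by rw [e1, hΛe]; linarith
  have b2 : Real.log (16 * n * K / δ) ≤ 3 * Λ := by rw [e2, hΛe]; linarith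
  have b3 : Real.log n ≤ Λ := by linarith
  have t1 : (n + 2) * Real.log (24 * m / δ) ≤ 3 * n * (5 * Λ + y / 16 + 1) := by
    have : (n + 2 : ℝ) ≤ 3 * n := by linarith
    exact (mul_le_mul_of_nonneg_left b1 (by positivity)).trans
      (mul_le_mul_of_nonneg_right this (by positivity))
  have t2 : (n + 1) * Real.log (16 * n * K / δ) ≤ 2 * n * (3 * Λ) := by
    have : (n + 1 : ℝ) ≤ 2 * n := by linarith
    exact (mul_le_mul_of_nonneg_left b2 (by positivity)).trans
      (mul_le_mul_of_nonneg_right this (by positivity))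
  have t3 : n * Real.log n ≤ n * Λ := by gcongr
  have e3 : δ ^ 4 * m = n * y := by rw [hy]; field_simp
  rw [e3]
  have : n * (22 * Λ + 3 * y / 16 + 3) ≤ n * y := by
    gcongr
    linarith
  linarith

/-- On the good event, the Erdős–Turán ratio is small. -/
lemma log_erdosTuranRatio_le {m n : ℕ} {K δ : ℝ} (hn : 1 ≤ n) (hK : 1 ≤ K) (h0 : 0 < δ)
    (h1 : δ < 1) (hmn : 100 * (δ ^ 4)⁻¹ * n * Real.log (Real.exp 1 * K * n / δ) ≤ m)
    {f : PowerSeries ℂ} {b : ℕ → ℝ} (hb : ∀ j ≤ m + n, PowerSeries.coeff j f = b j)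
    (hS : ∑ j ∈ Finset.range (m + n + 1), |b j| ≤ 24 * m / δ)
    (hb0 : δ / (16 * n * K) ≤ |b 0|)
    (hD : (δ / (16 * n * K)) ^ n ≤ ‖(toeplitz b m n).det‖)
    (hD' : (δ / (16 * n * K)) ^ (n + 1) ≤ ‖(toeplitz b m (n + 1)).det‖) {P : ℂ[X]}
    (hP : IsPadeNumerator f m n P) :
    P.coeff 0 ≠ 0 ∧ P.coeff m ≠ 0 ∧ P.natDegree = m ∧
      Real.log (erdosTuranRatio P) ≤ δ ^ 4 * m := by
  obtain ⟨hnm, hlog⟩ := log_ratio_bound_le hn hK h0 h1 hmn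
  have hn0 : (0 : ℝ) < n := by exact_mod_cast hn
  have hK0 : 0 < K := by linarith
  have hm1 : (1 : ℝ) ≤ m := by exact_mod_cast hn.trans hnm
  have hm0 : (0 : ℝ) < m := by linarith
  set ε := δ / (16 * n * K) with hε
  have hε0 : 0 < ε := by positivity
  set R := 24 * m / δ with hR
  have hR0 : 0 < R := by positivity
  obtain ⟨g1, g2, g3, g4⟩ := erdosTuranRatio_le hnm hb hS
    (abs_pos.1 (hε0.trans_le hb0)) (norm_pos_iff.1 ((pow_pos hε0 n).trans_le hD))
    (norm_pos_iff.1 ((pow_pos hε0 (n + 1)).trans_le hD')) hP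
  refine ⟨g1, g2, g3, ?_⟩
  have hpos : 0 < erdosTuranRatio P := by
    have hp0 := norm_pos_iff.2 g1
    have hpm := norm_pos_iff.2 g2
    rw [erdosTuranRatio, g3]
    refine div_pos ?_ (Real.sqrt_pos.2 (by positivity))
    exact hp0.trans_le (Finset.single_le_sum (f := fun k => ‖P.coeff k‖)
      (fun _ _ => norm_nonneg _) (by simp))
  -- The three lower bounds have exponents `n`, `n + 1` and `1`, whose product is a perfect square.
  have hsqrt : ε ^ (n + 1) ≤
      √(‖(toeplitz b m n).det‖ * ‖(toeplitz b m (n + 1)).det‖ * |b 0|) := by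
    refine Real.le_sqrt_of_sq_le ?_
    calc (ε ^ (n + 1)) ^ 2 = ε ^ n * ε ^ (n + 1) * ε := by ring
      _ ≤ _ := by gcongr
  have hmR : (m : ℝ) + 1 ≤ R := by
    rw [hR, le_div_iff₀ h0]; nlinarith
  have hfac : (n.factorial : ℝ) ≤ n ^ n := by exact_mod_cast Nat.factorial_le_pow n
  have hub : erdosTuranRatio P ≤ R ^ (n + 2) * n ^ n * (16 * n * K / δ) ^ (n + 1) := by
    calc erdosTuranRatio P ≤ R * R * (n ^ n * R ^ n) / ε ^ (n + 1) := by
          refine g4.trans ?_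
          gcongr
      _ = _ := by
          rw [hε, div_eq_mul_inv _ ((δ / (16 * n * K)) ^ (n + 1)), ← inv_pow, inv_div]
          ring
  refine (Real.log_le_log hpos hub).trans ((le_of_eq ?_).trans hlog)
  rw [Real.log_mul (by positivity) (by positivity), Real.log_mul (by positivity) (by positivity),
    Real.log_pow, Real.log_pow, Real.log_pow]
  push_cast
  ring

/-- The exceptional event for the coefficients has probability less than `δ`. -/
lemma measure_exceptional_lt {m n : ℕ} {K δ : ℝ} (hn : 1 ≤ n) (hnm : n ≤ m) (hK : 1 ≤ K)
    (h0 : 0 < δ) {N : ℕ} (hN : m + n ≤ N) {Ω : Type*} [MeasurableSpace Ω]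
    {μ : Measure Ω} [IsProbabilityMeasure μ] {a : Fin (N + 1) → Ω → ℝ}
    (ha : ∀ j, Measurable (a j)) (hiso : IsIsotropic μ a) (hind : iIndepFun a μ)
    (hlevy : ∀ j, ∀ ε : ℝ, 0 < ε → levyConcentration μ (a j) ε ≤ ENNReal.ofReal (K * ε)) :
    μ ({ω | 24 * m / δ ≤ ∑ j ∈ Finset.range (m + n + 1), |extendZero (fun j => a j ω) j|} ∪
      {ω | |extendZero (fun j => a j ω) 0| < δ / (16 * n * K)} ∪
      {ω | ‖(toeplitz (extendZero fun j => a j ω) m n).det‖ < (δ / (16 * n * K)) ^ n} ∪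
      {ω | ‖(toeplitz (extendZero fun j => a j ω) m (n + 1)).det‖ <
        (δ / (16 * n * K)) ^ (n + 1)}) < ENNReal.ofReal δ := by
  have hn' : (1 : ℝ) ≤ n := by exact_mod_cast hn
  have hnm' : (n : ℝ) ≤ m := by exact_mod_cast hnm
  have hm0 : (0 : ℝ) < m := by linarith
  have hK0 : 0 < K := by linarith
  -- With this `ε`, a determinant of size `k ≤ 2n` is small with probability at most `k K ε ≤ δ/8`.
  -- The radius `24 m / δ` likewise gives `δ/8` by Markov, as `m + n + 1 ≤ 3m`. The four events
  -- total `δ/2 < δ`.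
  set ε := δ / (16 * n * K) with hε
  have hε0 : 0 < ε := by positivity
  have hKε : K * ε = δ / (16 * n) := by rw [hε]; field_simp
  have hsmall : ∀ (j : Fin (N + 1)) (t : ℝ),
      μ {ω | |a j ω - t| < ε} ≤ ENNReal.ofReal (δ / (16 * n)) := fun j t => by
    rw [← hKε]
    exact (le_iSup (fun t => μ {ω | |a j ω - t| < ε}) t).trans (hlevy j ε hε0)
  have hq : ∀ k : ℕ, (k : ℝ) ≤ 2 * n →
      (k : ℝ≥0∞) * ENNReal.ofReal (δ / (16 * n)) ≤ ENNReal.ofReal (δ / 8) := by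
    intro k hk
    rw [← ENNReal.ofReal_natCast, ← ENNReal.ofReal_mul (by positivity)]
    refine ENNReal.ofReal_le_ofReal ?_
    rw [← mul_div_assoc, div_le_div_iff₀ (by positivity) (by norm_num)]
    nlinarith
  have p1 := measure_sum_abs_ge_le hiso (m + n + 1) (R := 24 * m / δ) (by positivity)
  have p1' : ENNReal.ofReal (((m + n + 1 : ℕ) : ℝ) / (24 * m / δ)) ≤ ENNReal.ofReal (δ / 8) := by
    refine ENNReal.ofReal_le_ofReal ?_
    rw [div_le_iff₀ (by positivity)]
    push_cast
    field_simp
    linarith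
  have p2 : μ {ω | |extendZero (fun j => a j ω) 0| < ε} ≤ ENNReal.ofReal (δ / 8) := by
    have h2 := (hsmall ⟨0, by omega⟩ 0).trans
      ((one_mul (ENNReal.ofReal (δ / (16 * n)))).symm.le.trans (by simpa using hq 1 (by norm_num; linarith)))
    simpa [extendZero] using h2
  have p3 := (measure_norm_det_toeplitz_lt_le ha hind (m := m) (k := n) (by omega) (by omega)
    hε0.le (hsmall _)).trans (hq n (by linarith))
  have p4 := (measure_norm_det_toeplitz_lt_le ha hind (m := m) (k := n + 1) (by omega) (by omega)
    hε0.le (hsmall _)).trans (hq (n + 1) (by push_cast; linarith))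
  refine lt_of_le_of_lt ((measure_union_le _ _).trans (add_le_add ((measure_union_le _ _).trans
    (add_le_add ((measure_union_le _ _).trans (add_le_add (p1.trans p1') p2)) p3)) p4)) ?_
  rw [← ENNReal.ofReal_add (by positivity) (by positivity),
    ← ENNReal.ofReal_add (by positivity) (by positivity),
    ← ENNReal.ofReal_add (by positivity) (by positivity)]
  exact (ENNReal.ofReal_lt_ofReal_iff h0).2 (by linarith)

end PadeClustering

end

open PadeClustering in
theorem theorem3p2 :
    ∃ C : ℝ, 0 < C ∧
      ∀ (m n : ℕ) (K δ : ℝ), 1 ≤ m → 1 ≤ n → 1 ≤ K → 0 < δ → δ < 1 →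
      C * (δ ^ 4)⁻¹ * n * Real.log (Real.exp 1 * K * n / δ) ≤ m →
      ∀ (N : ℕ), m + n ≤ N →
      ∀ (Ω : Type*) [MeasurableSpace Ω] (μ : Measure Ω) [IsProbabilityMeasure μ]
        (a : Fin (N + 1) → Ω → ℝ),
        (∀ j, Measurable (a j)) →
        IsIsotropic μ a →
        iIndepFun a μ →
        (∀ j, ∀ ε : ℝ, 0 < ε → levyConcentration μ (a j) ε ≤ ENNReal.ofReal (K * ε)) →
        μ {ω | ∃ P : ℂ[X], IsPadeNumerator (polyOfCoeffs (fun j => a j ω) : PowerSeries ℂ) m n P ∧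
            (P.coeff 0 = 0 ∨ P.coeff m = 0 ∨ δ ^ 4 < Real.log (erdosTuranRatio P) / m)}
          < ENNReal.ofReal δ ∧
        μ {ω | ∃ P : ℂ[X], IsPadeNumerator (polyOfCoeffs (fun j => a j ω) : PowerSeries ℂ) m n P ∧
            (P.coeff 0 = 0 ∨ P.coeff m = 0 ∨ 40 * δ < dBL (zeroMeasure P) uniformCircle)}
          < ENNReal.ofReal δ := by
  refine ⟨100, by norm_num, ?_⟩
  intro m n K δ hm hn hK h0 h1 hmn N hN Ω _ μ _ a ha hiso hind hlevy
  have hnm := (log_ratio_bound_le hn hK h0 h1 hmn).1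
  have hm0 : (0 : ℝ) < m := by exact_mod_cast hm
  have hexc := measure_exceptional_lt hn hnm hK h0 hN ha hiso hind hlevy
  have hgood : ∀ ω, ω ∉ ({ω | 24 * m / δ ≤
        ∑ j ∈ Finset.range (m + n + 1), |extendZero (fun j => a j ω) j|} ∪
      {ω | |extendZero (fun j => a j ω) 0| < δ / (16 * n * K)} ∪
      {ω | ‖(toeplitz (extendZero fun j => a j ω) m n).det‖ < (δ / (16 * n * K)) ^ n} ∪
      {ω | ‖(toeplitz (extendZero fun j => a j ω) m (n + 1)).det‖ <
        (δ / (16 * n * K)) ^ (n + 1)}) → ∀ P : ℂ[X],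
      IsPadeNumerator (polyOfCoeffs (fun j => a j ω) : PowerSeries ℂ) m n P →
      P.coeff 0 ≠ 0 ∧ P.coeff m ≠ 0 ∧ P.natDegree = m ∧
        Real.log (erdosTuranRatio P) ≤ δ ^ 4 * m := by
    intro ω hω P hP
    simp only [Set.mem_union, Set.mem_ofPred_eq, not_or, not_le, not_lt] at hω
    obtain ⟨⟨⟨q1, q2⟩, q3⟩, q4⟩ := hω
    exact log_erdosTuranRatio_le hn hK h0 h1 hmn (fun j _ => coeff_polyOfCoeffs _ j) q1.le q2 q3 q4 hP
  constructor
  -- Monotonicity holds for outer measure, so measurability of the event over all admissible `P` is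
  -- not needed.
  · refine (measure_mono ?_).trans_lt hexc
    rintro ω ⟨P, hP, hbad⟩
    by_contra hω
    obtain ⟨g1, g2, -, g4⟩ := hgood ω hω P hP
    rcases hbad with h | h | h
    · exact g1 h
    · exact g2 h
    · rw [lt_div_iff₀ hm0] at h
      linarith
  · refine (measure_mono ?_).trans_lt hexc
    rintro ω ⟨P, hP, hbad⟩
    by_contra hω
    obtain ⟨g1, g2, g3, g4⟩ := hgood ω hω P hP
    rcases hbad with h | h | h
    · exact g1 h
    · exact g2 h
    · refine absurd (dBL_zeroMeasure_uniformCircle_le h0 h1 g1 (by omega) ?_) (not_le.2 h)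
      rwa [g3]
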